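/- Let $k$ be a field, let $T$ and $S$ be bialgebras over $k$, and let $A$ be a commutative $k$-algebra. For bialgebras $N,R$ a linear map $\psi\colon N\otimes R\to A$, written $\psi(n,r)$, is a *bimeasuring* if (in Sweedler notation) $\psi(nm,r)=\psi(n,r_1)\psi(m,r_2)$, $\psi(1,r)=\varepsilon(r)1$, $\psi(n,rr')=\psi(n_1,r)\psi(n_2,r')$ and $\psi(n,1)=\varepsilon(n)1$. A bimeasuring $\theta_R\colon B(R,A)\otimes R\to A$ is *universal* if for every bimeasuring $f\colon N\otimes R\to A$ there is a unique bialgebra map $\overline f\colon N\to B(R,A)$ with $f=\theta_R(\overline f\otimes 1)$; requiring $N$ and the representing bialgebra to be cocommutative gives the *universal cocommutative bimeasuring bialgebra* $B_c(R,A)$. For a bialgebra $H$ let $H_c$ denote the sum of all cocommutative subcoalgebras of $H$; it is a subbialgebra. Then the universal bimeasuring bialgebras $B(T,A)$, $B(S,A)$ and $B(T\otimes S,A)$ exist, and the following hold. 1. There is a unique coalgebra map $\alpha\colon B(T,A)\otimes B(S,A)\to B(T\otimes S,A)$ with $$\theta_{T\otimes S}(\alpha(f\otimes g),\,t\otimes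 s)=\theta_T(f,t)\,\theta_S(g,s)$$ for all $f,g,t,s$, and it is a bialgebra map. 2. Let $\overline{\iota_1}\colon B(T\otimes S,A)\to B(T,A)$ and $\overline{\iota_2}\colon B(T\otimes S,A)\to B(S,A)$ be the bialgebra maps induced by the inclusions $t\mapsto t\otimes 1$ and $s\mapsto 1\otimes s$, i.e. the unique bialgebra maps with $\theta_T(\overline{\iota_1}(b),t)=\theta_{T\otimes S}(b,t\otimes 1)$ and $\theta_S(\overline{\iota_2}(b),s)=\theta_{T\otimes S}(b,1\otimes s)$. Then the linear map $\overline{\iota_1}*\overline{\iota_2}\colon b\mapsto \overline{\iota_1}(b_1)\otimes\overline{\iota_2}(b_2)$ is a left inverse of $\alpha$; in particular $\alpha$ is injective. 3. For $R=T$, $S$, $T\otimes S$, the cocommutative part $B(R,A)_c$, with the restriction of $\theta_R$, is the universal cocommutative bimeasuring bialgebra $B_c(R,A)$, and $\alpha$ restricts to an isomorphism of bialgebras $$B_c(T,A)\otimes B_c(S,A)\;\cong\; B_c(T\otimes S,A).$$ -/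

import Mathlib

open scoped TensorProduct

universe u

noncomputable section

/-! ### The cocommutative part of a bialgebra -/

section CocommPart

variable (k : Type*) {H : Type*} [Field k] [Ring H] [Bialgebra k H]

/-- A subspace `C` of `H` is a cocommutative subcoalgebra if the comultiplication maps `C` into
(the image in `H ⊗ H` of) `C ⊗ C` and takes symmetric values on `C`. -/
def IsCocommSubcoalgebra (C : Submodule k H) : Prop :=
  ∀ x ∈ C, Coalgebra.comul (R := k) x ∈ LinearMap.range (TensorProduct.map C.subtype C.subtype) ∧
    TensorProduct.comm k H H (Coalgebra.comul x) = Coalgebra.comul x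

variable (H) in
/-- The sum of all cocommutative subcoalgebras of `H`, as a subspace. -/
def cocommSubmodule : Submodule k H :=
  sSup {C : Submodule k H | IsCocommSubcoalgebra k C}

theorem range_map_subtype_mono {C D : Submodule k H} (h : C ≤ D) :
    LinearMap.range (TensorProduct.map C.subtype C.subtype) ≤
      LinearMap.range (TensorProduct.map D.subtype D.subtype) := by
  rintro _ ⟨x, rfl⟩
  refine ⟨TensorProduct.map (Submodule.inclusion h) (Submodule.inclusion h) x, ?_⟩
  rw [← LinearMap.comp_apply, ← TensorProduct.map_comp]
  rfl

/-- The sum of all cocommutative subcoalgebras is a cocommutative subcoalgebra. -/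
theorem isCocommSubcoalgebra_cocommSubmodule :
    IsCocommSubcoalgebra k (cocommSubmodule k H) := by
  let P := cocommSubmodule k H
  let Q : Submodule k H :=
    (LinearMap.range (TensorProduct.map P.subtype P.subtype)).comap Coalgebra.comul ⊓
      LinearMap.eqLocus ((TensorProduct.comm k H H).toLinearMap ∘ₗ Coalgebra.comul)
        Coalgebra.comul
  have hPQ : P ≤ Q := sSup_le fun C hC x hx =>
    ⟨range_map_subtype_mono k (le_sSup hC) (hC x hx).1, (hC x hx).2⟩
  exact fun x hx => ⟨(hPQ hx).1, (hPQ hx).2⟩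

theorem one_mem_cocommSubmodule : (1 : H) ∈ cocommSubmodule k H := by
  have h : IsCocommSubcoalgebra k (Submodule.span k {(1 : H)}) := by
    intro x hx
    obtain ⟨c, rfl⟩ := Submodule.mem_span_singleton.1 hx
    rw [map_smul, Bialgebra.comul_one, Algebra.TensorProduct.one_def]
    refine ⟨⟨c • (⟨1, Submodule.mem_span_singleton_self _⟩ ⊗ₜ
      ⟨1, Submodule.mem_span_singleton_self _⟩), by simp⟩, by simp⟩
  exact (le_sSup (show Submodule.span k {(1 : H)} ∈ {C | IsCocommSubcoalgebra k C} from h) :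
    Submodule.span k {(1 : H)} ≤ cocommSubmodule k H) (Submodule.mem_span_singleton_self _)

theorem mul_mem_cocommSubmodule {x y : H} (hx : x ∈ cocommSubmodule k H)
    (hy : y ∈ cocommSubmodule k H) : x * y ∈ cocommSubmodule k H := by
  let P := cocommSubmodule k H
  have hP : IsCocommSubcoalgebra k P := isCocommSubcoalgebra_cocommSubmodule k
  let Q : Submodule k H :=
    (LinearMap.range (TensorProduct.map (P * P).subtype (P * P).subtype)).comap Coalgebra.comul ⊓
      LinearMap.eqLocus ((TensorProduct.comm k H H).toLinearMap ∘ₗ Coalgebra.comul)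
        Coalgebra.comul
  have hR : ∀ a ∈ LinearMap.range (TensorProduct.map P.subtype P.subtype),
      ∀ b ∈ LinearMap.range (TensorProduct.map P.subtype P.subtype),
      a * b ∈ LinearMap.range (TensorProduct.map (P * P).subtype (P * P).subtype) := by
    rintro _ ⟨a, rfl⟩ _ ⟨b, rfl⟩
    induction a using TensorProduct.induction_on with
    | zero => simp
    | add a a' ha ha' => rw [map_add, add_mul]; exact add_mem ha ha'
    | tmul p q =>
      induction b using TensorProduct.induction_on with
      | zero => simp
      | add b b' hb hb' => rw [map_add, mul_add]; exact add_mem hb hb'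
      | tmul r s =>
        exact ⟨⟨p * r, Submodule.mul_mem_mul p.2 r.2⟩ ⊗ₜ
          ⟨q * s, Submodule.mul_mem_mul q.2 s.2⟩, by simp⟩
  have hQ : P * P ≤ Q := by
    refine Submodule.mul_le.2 fun a ha b hb => ⟨?_, ?_⟩
    · change Coalgebra.comul (R := k) (a * b) ∈
        LinearMap.range (TensorProduct.map (P * P).subtype (P * P).subtype)
      rw [Bialgebra.comul_mul]
      exact hR _ (hP a ha).1 _ (hP b hb).1
    · change TensorProduct.comm k H H (Coalgebra.comul (R := k) (a * b)) = Coalgebra.comul (a * b)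
      have hc : ∀ z : H ⊗[k] H,
        TensorProduct.comm k H H z = Algebra.TensorProduct.comm k H H z := fun _ => rfl
      rw [Bialgebra.comul_mul, hc, map_mul, ← hc, ← hc, (hP a ha).2, (hP b hb).2]
  have hPP : IsCocommSubcoalgebra k (P * P) := fun z hz => ⟨(hQ hz).1, (hQ hz).2⟩
  exact (le_sSup (show P * P ∈ {C | IsCocommSubcoalgebra k C} from hPP) :
    P * P ≤ cocommSubmodule k H) (Submodule.mul_mem_mul hx hy)

variable (H) in
/-- The cocommutative part `H_c` of a bialgebra `H`: the largest cocommutative subcoalgebra,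
obtained as the sum of all cocommutative subcoalgebras; it is a subalgebra of `H`. -/
def cocommPart : Subalgebra k H :=
  (cocommSubmodule k H).toSubalgebra (one_mem_cocommSubmodule k)
    (fun _ _ hx hy => mul_mem_cocommSubmodule k hx hy)

variable (H) in
/-- The inclusion `H_c ⊗ H_c → H ⊗ H`. -/
def cocommPartTensorIncl : (cocommPart k H ⊗[k] cocommPart k H) →ₐ[k] (H ⊗[k] H) :=
  Algebra.TensorProduct.map (cocommPart k H).val (cocommPart k H).val

theorem cocommPart_val_injective :
    Function.Injective (cocommPart k H).val.toLinearMap := Subtype.val_injective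

theorem cocommPartTensorIncl_injective :
    Function.Injective (cocommPartTensorIncl k H) :=
  TensorProduct.map_injective_of_flat_flat _ _
    (cocommPart_val_injective k) (cocommPart_val_injective k)

theorem comul_mem_range_cocommPartTensorIncl (x : cocommPart k H) :
    Coalgebra.comul (R := k) (x : H) ∈ (cocommPartTensorIncl k H).range :=
  (isCocommSubcoalgebra_cocommSubmodule k (x : H) x.2).1

variable (H) in
/-- The comultiplication of `H_c`: the restriction of that of `H`. -/
def cocommPartComul : cocommPart k H →ₐ[k] (cocommPart k H ⊗[k] cocommPart k H) :=
  (AlgEquiv.ofInjective (cocommPartTensorIncl k H) (cocommPartTensorIncl_injective k)).symm.toAlgHom.comp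
    (((Bialgebra.comulAlgHom k H).comp (cocommPart k H).val).codRestrict
      (cocommPartTensorIncl k H).range (comul_mem_range_cocommPartTensorIncl k))

theorem cocommPartTensorIncl_comul (x : cocommPart k H) :
    cocommPartTensorIncl k H (cocommPartComul k H x) = Coalgebra.comul (R := k) (x : H) :=
  congrArg Subtype.val
    ((AlgEquiv.ofInjective (cocommPartTensorIncl k H) (cocommPartTensorIncl_injective k)).apply_symm_apply
      ⟨Coalgebra.comul (R := k) (x : H), comul_mem_range_cocommPartTensorIncl k x⟩)

theorem map_val_comp_cocommPartComul :
    TensorProduct.map (cocommPart k H).val.toLinearMap (cocommPart k H).val.toLinearMap ∘ₗ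
      (cocommPartComul k H).toLinearMap =
    Coalgebra.comul ∘ₗ (cocommPart k H).val.toLinearMap :=
  LinearMap.ext (cocommPartTensorIncl_comul k)

/-- `H_c` with the restricted counit and comultiplication is a coalgebra. -/
instance cocommPartCoalgebra : Coalgebra k (cocommPart k H) where
  comul := (cocommPartComul k H).toLinearMap
  counit := Coalgebra.counit ∘ₗ (cocommPart k H).val.toLinearMap
  coassoc := by
    set j := (cocommPart k H).val.toLinearMap with hj
    set D := (cocommPartComul k H).toLinearMap with hD
    have h : TensorProduct.map j j ∘ₗ D = Coalgebra.comul ∘ₗ j := map_val_comp_cocommPartComul k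
    have hinj : Function.Injective (TensorProduct.map j (TensorProduct.map j j)) :=
      TensorProduct.map_injective_of_flat_flat _ _ (cocommPart_val_injective k)
        (cocommPartTensorIncl_injective k)
    refine LinearMap.ext fun x => hinj ?_
    have hx : TensorProduct.map j j (D x) = Coalgebra.comul (j x) := LinearMap.congr_fun h x
    have e1 : ∀ z, TensorProduct.map j (TensorProduct.map j j)
        (TensorProduct.assoc k _ _ _ (D.rTensor _ z)) =
        TensorProduct.assoc k _ _ _
          ((Coalgebra.comul (R := k) (A := H)).rTensor _ (TensorProduct.map j j z)) := by
      intro z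
      induction z using TensorProduct.induction_on with
      | zero => simp
      | add a b ha hb => simp only [map_add, ha, hb]
      | tmul a b =>
        have ha : TensorProduct.map j j (D a) = Coalgebra.comul (j a) := LinearMap.congr_fun h a
        rw [LinearMap.rTensor_tmul, TensorProduct.map_tmul, LinearMap.rTensor_tmul, ← ha]
        generalize D a = w
        induction w using TensorProduct.induction_on with
        | zero => simp
        | add a b ha hb => simp only [map_add, TensorProduct.add_tmul, ha, hb]
        | tmul p q => simp
    have e2 : ∀ z, TensorProduct.map j (TensorProduct.map j j) (D.lTensor _ z) =
          ((Coalgebra.comul (R := k) (A := H)).lTensor _ (TensorProduct.map j j z)) := by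
      intro z
      rw [LinearMap.lTensor, LinearMap.lTensor, ← LinearMap.comp_apply, ← LinearMap.comp_apply,
        ← TensorProduct.map_comp, ← TensorProduct.map_comp, h, LinearMap.comp_id,
        LinearMap.id_comp]
    simp only [LinearMap.comp_apply, LinearEquiv.coe_coe]
    rw [e1, e2, hx]
    exact Coalgebra.coassoc_apply _
  rTensor_counit_comp_comul := by
    set j := (cocommPart k H).val.toLinearMap with hj
    set D := (cocommPartComul k H).toLinearMap with hD
    have h : TensorProduct.map j j ∘ₗ D = Coalgebra.comul ∘ₗ j := map_val_comp_cocommPartComul k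
    have hinj : Function.Injective (TensorProduct.map (LinearMap.id (R := k) (M := k)) j) :=
      TensorProduct.map_injective_of_flat_flat _ _ Function.injective_id
        (cocommPart_val_injective k)
    refine LinearMap.ext fun x => hinj ?_
    have hx : TensorProduct.map j j (D x) = Coalgebra.comul (j x) := LinearMap.congr_fun h x
    rw [LinearMap.comp_apply, LinearMap.rTensor, ← LinearMap.comp_apply, ← TensorProduct.map_comp,
      LinearMap.id_comp, LinearMap.comp_id]
    have := Coalgebra.rTensor_counit_comul (R := k) (j x)
    rw [← hx, LinearMap.rTensor, ← LinearMap.comp_apply, ← TensorProduct.map_comp,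
      LinearMap.id_comp] at this
    simpa using this
  lTensor_counit_comp_comul := by
    set j := (cocommPart k H).val.toLinearMap with hj
    set D := (cocommPartComul k H).toLinearMap with hD
    have h : TensorProduct.map j j ∘ₗ D = Coalgebra.comul ∘ₗ j := map_val_comp_cocommPartComul k
    have hinj : Function.Injective (TensorProduct.map j (LinearMap.id (R := k) (M := k))) :=
      TensorProduct.map_injective_of_flat_flat _ _ (cocommPart_val_injective k)
        Function.injective_id
    refine LinearMap.ext fun x => hinj ?_
    have hx : TensorProduct.map j j (D x) = Coalgebra.comul (j x) := LinearMap.congr_fun h x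
    rw [LinearMap.comp_apply, LinearMap.lTensor, ← LinearMap.comp_apply, ← TensorProduct.map_comp,
      LinearMap.id_comp, LinearMap.comp_id]
    have := Coalgebra.lTensor_counit_comul (R := k) (j x)
    rw [← hx, LinearMap.lTensor, ← LinearMap.comp_apply, ← TensorProduct.map_comp,
      LinearMap.id_comp] at this
    simpa using this

/-- `H_c` is a bialgebra. -/
instance cocommPartBialgebra : Bialgebra k (cocommPart k H) :=
  Bialgebra.mk' k (cocommPart k H) (Bialgebra.counit_one (R := k) (A := H))
    (fun {a b} => Bialgebra.counit_mul (R := k) (a : H) (b : H))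
    (map_one (cocommPartComul k H))
    (fun {a b} => map_mul (cocommPartComul k H) a b)

end CocommPart

/-! ### Measurings and bimeasurings -/

section Bimeasuring

variable {k : Type*} [Field k]

/-- A bilinear map `ψ : C × B → A` (equivalently, a linear map `C ⊗ B → A`), where `C` is a
coalgebra and `A`, `B` are algebras, is a measuring if `ψ(c, b b') = ψ(c₁, b) ψ(c₂, b')` and
`ψ(c, 1) = ε(c) 1`. -/
structure IsMeasuring {C B A : Type*} [AddCommGroup C] [Module k C] [Coalgebra k C]
    [Ring B] [Algebra k B] [Ring A] [Algebra k A] (ψ : C →ₗ[k] B →ₗ[k] A) : Prop where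
  map_mul : ∀ (c : C) (b b' : B), ψ c (b * b') =
    LinearMap.mul' k A (TensorProduct.map (ψ.flip b) (ψ.flip b') (Coalgebra.comul c))
  map_one : ∀ c : C, ψ c 1 = algebraMap k A (Coalgebra.counit c)

/-- A bilinear map `ψ : N × T → A`, with `N` and `T` bialgebras and `A` an algebra, is a
bimeasuring if `N` measures `T` to `A` and `T` measures `N` to `A`. -/
structure IsBimeasuring {N T A : Type*} [Ring N] [Bialgebra k N] [Ring T] [Bialgebra k T]
    [Ring A] [Algebra k A] (ψ : N →ₗ[k] T →ₗ[k] A) : Prop where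
  left : IsMeasuring ψ
  right : IsMeasuring ψ.flip

end Bimeasuring

section Universal

variable {k T A B : Type u} [Field k] [Ring T] [Bialgebra k T] [Ring A] [Algebra k A]
  [Ring B] [Bialgebra k B]

/-- `θ : B × T → A` is the (left) universal bimeasuring, and `B` the (left) universal bimeasuring
bialgebra `B(T, A)`: `θ` is a bimeasuring, and every bimeasuring `f : N × T → A` is
`θ(φ(-), -)` for a unique bialgebra map `φ : N → B`. -/
structure IsUniversalBimeasuring (θ : B →ₗ[k] T →ₗ[k] A) : Prop where
  isBimeasuring : IsBimeasuring θ
  existsUnique_lift : ∀ (N : Type u) [Ring N] [Bialgebra k N] (f : N →ₗ[k] T →ₗ[k] A),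
    IsBimeasuring f → ∃! φ : N →ₐc[k] B, ∀ (n : N) (t : T), θ (φ n) t = f n t

/-- `θ : B × T → A` is the universal cocommutative bimeasuring, and `B` the universal
cocommutative bimeasuring bialgebra `B_c(T, A)`: the same as above with all left-hand
bialgebras restricted to cocommutative ones. -/
structure IsUniversalCocommBimeasuring (θ : B →ₗ[k] T →ₗ[k] A) : Prop where
  isCocomm : Coalgebra.IsCocomm k B
  isBimeasuring : IsBimeasuring θ
  existsUnique_lift : ∀ (N : Type u) [Ring N] [Bialgebra k N] [Coalgebra.IsCocomm k N]
    (f : N →ₗ[k] T →ₗ[k] A),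
    IsBimeasuring f → ∃! φ : N →ₐc[k] B, ∀ (n : N) (t : T), θ (φ n) t = f n t

variable (k T A) in
/-- The universal bimeasuring bialgebra `B(T, A)` exists. -/
def HasUniversalBimeasuring : Prop :=
  ∃ (B : Type u) (_ : Ring B) (_ : Bialgebra k B) (θ : B →ₗ[k] T →ₗ[k] A),
    IsUniversalBimeasuring θ

/-- The restriction of `θ : B × T → A` to the cocommutative part `B_c` of `B`. -/
def restrictCocomm (θ : B →ₗ[k] T →ₗ[k] A) : cocommPart k B →ₗ[k] T →ₗ[k] A :=
  θ ∘ₗ (cocommPart k B).val.toLinearMap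

end Universal

end

/-!
The key point is that for commutative `A` the universal bimeasuring bialgebra of `T` is the
universal measuring coalgebra of `T`, so that its universal property applies to all measurings by
coalgebras.

A measuring of `T` to `A` by the `n × n` comatrix coalgebra is the same as an algebra map `T →
Mat_n(A)`, and every element of a coalgebra is a linear combination of the entries of a comatrix
(`exists_isComatrix_mem_span`). The direct sum of comatrix coalgebras over all representations `T →
Mat_n(A)` is therefore large enough to see every measuring. Its quotient by the largest coideal on
which the pairing with `T` vanishes is universal (`isUniversalMeasuring_maxCoidealLift_repPairing`):
two coalgebra maps into this quotient that induce the same pairing are equal, because the image of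
their difference is a coideal on which the pairing vanishes (`coalgHom_ext_maxCoideal`).

If `T` is a bialgebra and `A` is commutative, the convolution product of two measurings is a
measuring. This gives the universal measuring coalgebra a multiplication, whose laws follow from
those of the convolution ring by uniqueness of lifts
(`IsUniversalMeasuring.exists_isUniversalBimeasuring`). By uniqueness up to isomorphism, coalgebra
maps into any universal bimeasuring bialgebra are determined by their pairings
(`IsUniversalBimeasuring.coalgHom_ext`), and all the identities below are proved by comparing
pairings.

The map `α` comes from the product of the two universal bimeasurings. The composites `ι₁ α` and `ι₂
α` are `id ⊗ ε` and `ε ⊗ id`, so `ι₁ * ι₂` is a left inverse of `α`. On a cocommutative coalgebra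
the comultiplication is a coalgebra map, so there `α (ι₁ * ι₂)` is a coalgebra map, and comparing
pairings shows that it is the inclusion (`tensor_map_induced_comul`). Since coalgebra maps from
cocommutative coalgebras land in the cocommutative part (`coalgHom_mem_cocommPart`), this gives the
surjectivity of `α` between the cocommutative parts, as well as their universality.
-/

noncomputable section

/-! ### Comatrices and the fundamental theorem of coalgebras -/

section Comatrix

open TensorProduct in
/-- Every tensor is a finite sum `∑ aᵢ ⊗ vᵢ` in which the `vᵢ` are linearly independent and each
`vᵢ` is obtained by applying a functional to the left factor of the tensor. -/
theorem TensorProduct.exists_sum_tmul_linearIndependent {k M N : Type*} [Field k] [AddCommGroup M]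
    [Module k M] [AddCommGroup N] [Module k N] (z : M ⊗[k] N) :
    ∃ (n : ℕ) (a : Fin n → M) (v : Fin n → N) (f : Fin n → Module.Dual k M),
      LinearIndependent k v ∧ z = ∑ i, a i ⊗ₜ v i ∧
        ∀ i, v i = TensorProduct.lid k N ((f i).rTensor N z) := by
  classical
  let F : Module.Dual k M →ₗ[k] N :=
    (TensorProduct.lid k N).toLinearMap ∘ₗ LinearMap.applyₗ z ∘ₗ LinearMap.rTensorHom N
  let V := LinearMap.range F
  -- the contractions of `z` by functionals on `M` form a finite-dimensional space `V`
  have hfin : FiniteDimensional k V := by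
    obtain ⟨s, hs⟩ := TensorProduct.exists_finset z
    have : V ≤ Submodule.span k (s.image Prod.snd : Set N) := by
      rintro _ ⟨f, rfl⟩
      have : F f = ∑ p ∈ s, f p.1 • p.2 := by simp [F, hs, map_sum]
      rw [this]
      exact Submodule.sum_mem _ fun p hp => Submodule.smul_mem _ _
        (Submodule.subset_span (Finset.mem_coe.2 (Finset.mem_image_of_mem _ hp)))
    have := FiniteDimensional.span_finset k (s.image Prod.snd)
    exact Submodule.finiteDimensional_of_le ‹V ≤ _›
  -- `z` lies in `M ⊗ V`, since functionals on `M` separate the points of `M ⊗ (N / V)`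
  have hz : V.mkQ.lTensor M z = 0 := by
    apply (TensorProduct.equivFinsuppOfBasisLeft (N := N ⧸ V)
      (Module.Basis.ofVectorSpace k M)).injective
    ext i
    have h : ∀ w : M ⊗[k] N, TensorProduct.equivFinsuppOfBasisLeft (Module.Basis.ofVectorSpace k M)
        (V.mkQ.lTensor M w) i = V.mkQ (TensorProduct.lid k N
          (((Module.Basis.ofVectorSpace k M).coord i).rTensor N w)) := by
      intro w
      induction w with
      | zero => simp
      | add a b ha hb => simp only [map_add, Finsupp.add_apply, ha, hb]
      | tmul m n => simp
    rw [h, map_zero, Finsupp.zero_apply, Submodule.mkQ_apply, Submodule.Quotient.mk_eq_zero]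
    exact ⟨(Module.Basis.ofVectorSpace k M).coord i, rfl⟩
  obtain ⟨w, hw⟩ := (lTensor_exact M (LinearMap.exact_subtype_mkQ V) V.mkQ_surjective z).1 hz
  let b := Module.finBasis k V
  have hf : ∀ i, ∃ f, F f = b i := fun i => (b i).2
  choose f hf using hf
  refine ⟨_, equivFinsuppOfBasisRight b w, fun i => b i, f, ?_, ?_, fun i => (hf i).symm⟩
  · exact b.linearIndependent.map' V.subtype (Submodule.ker_subtype V)
  · rw [← hw]
    conv_lhs => rw [← (equivFinsuppOfBasisRight b).symm_apply_apply w]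
    rw [equivFinsuppOfBasisRight_symm_apply, Finsupp.sum_fintype _ _ (by simp), map_sum]
    simp

open Coalgebra

/-- A square family of elements of a coalgebra is a comatrix if it is comultiplied and counited
like the matrix coefficients of a representation: `Δ cᵢⱼ = ∑ₗ cᵢₗ ⊗ cₗⱼ` and `ε cᵢⱼ = δᵢⱼ`. -/
structure IsComatrix (k : Type*) {C : Type*} [Field k] [AddCommGroup C] [Module k C]
    [Coalgebra k C] {n : ℕ} (c : Fin n → Fin n → C) : Prop where
  comul_eq : ∀ i j, comul (R := k) (c i j) = ∑ l, c i l ⊗ₜ c l j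
  counit_eq : ∀ i j, counit (R := k) (c i j) = if i = j then 1 else 0

variable {k C : Type*} [Field k] [AddCommGroup C] [Module k C] [Coalgebra k C]

theorem LinearIndependent.eq_of_sum_tmul_eq {M : Type*} [AddCommGroup M] [Module k M]
    {N : Type*} [AddCommGroup N] [Module k N] {n : ℕ} {v : Fin n → N} (hv : LinearIndependent k v)
    {a b : Fin n → M} (h : ∑ i, a i ⊗ₜ[k] v i = ∑ i, b i ⊗ₜ v i) : a = b := by
  obtain ⟨g, hg⟩ := LinearMap.exists_leftInverse_of_injective
    (Finsupp.linearCombination k v) (LinearMap.ker_eq_bot.2 hv)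
  have hg' : ∀ i, g (v i) = Finsupp.single i 1 := fun i => by
    simpa using LinearMap.congr_fun hg (Finsupp.single i 1)
  funext j
  have := congrArg (fun z => TensorProduct.rid k M ((Finsupp.lapply j ∘ₗ g).lTensor M z)) h
  simpa [map_sum, hg', Finsupp.single_apply, Finset.sum_ite_eq] using this

/-- The coefficients of a left coideal with respect to a basis of it form a comatrix. -/
theorem LinearIndependent.isComatrix {n : ℕ} {v : Fin n → C} (hv : LinearIndependent k v)
    {c : Fin n → Fin n → C} (hc : ∀ i, comul (R := k) (v i) = ∑ j, c i j ⊗ₜ v j) :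
    IsComatrix k c := by
  constructor
  · intro i
    refine congrFun (hv.eq_of_sum_tmul_eq ?_)
    have h := coassoc_symm_apply (R := k) (v i)
    rw [hc, map_sum, map_sum, map_sum] at h
    simp only [LinearMap.lTensor_tmul, LinearMap.rTensor_tmul, hc, TensorProduct.tmul_sum,
      map_sum, TensorProduct.assoc_symm_tmul] at h
    rw [← h, Finset.sum_comm]
    simp [TensorProduct.sum_tmul]
  · intro i
    refine congrFun (hv.eq_of_sum_tmul_eq ?_)
    have h := rTensor_counit_comul (R := k) (v i)
    rw [hc, map_sum] at h
    simpa [ite_smul, TensorProduct.ite_tmul] using h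

theorem mem_span_of_comul_eq {n : ℕ} {v : Fin n → C}
    {c : Fin n → Fin n → C} {i : Fin n} (hc : comul (R := k) (v i) = ∑ j, c i j ⊗ₜ v j) :
    v i ∈ Submodule.span k (Set.range fun p : Fin n × Fin n => c p.1 p.2) := by
  have h := congrArg (TensorProduct.rid k C) (lTensor_counit_comul (R := k) (v i))
  rw [hc, map_sum, map_sum] at h
  simp only [LinearMap.lTensor_tmul, TensorProduct.rid_tmul, one_smul] at h
  rw [← h]
  exact Submodule.sum_mem _ fun j _ => Submodule.smul_mem _ _ (Submodule.subset_span ⟨(i, j), rfl⟩)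

/-- A form of the fundamental theorem of coalgebras: every element of a coalgebra is a linear
combination of the entries of a comatrix. The comatrix is that of the left coideal generated by the
element. -/
theorem exists_isComatrix_mem_span (x : C) : ∃ (n : ℕ) (c : Fin n → Fin n → C),
    IsComatrix k c ∧ x ∈ Submodule.span k (Set.range fun p : Fin n × Fin n => c p.1 p.2) := by
  obtain ⟨n, a, v, f, hv, hz, hf⟩ :=
    TensorProduct.exists_sum_tmul_linearIndependent (comul (R := k) x)
  let c : Fin n → Fin n → C := fun i j => TensorProduct.lid k C ((f i).rTensor C (comul (a j)))
  have hc : ∀ i, comul (R := k) (v i) = ∑ j, c i j ⊗ₜ v j := by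
    intro i
    have e1 : ∀ z : C ⊗[k] C, comul (R := k) (TensorProduct.lid k C ((f i).rTensor C z)) =
        TensorProduct.lid k _ ((f i).rTensor _ (comul.lTensor C z)) := fun z => by
      induction z with
      | zero => simp
      | add p q hp hq => simp only [map_add, hp, hq]
      | tmul p q => simp
    have e2 : ∀ (w : C ⊗[k] C) (y : C),
        TensorProduct.lid k _ ((f i).rTensor _ (TensorProduct.assoc k C C C (w ⊗ₜ y))) =
        TensorProduct.lid k C ((f i).rTensor C w) ⊗ₜ y := fun w y => by
      induction w with
      | zero => simp
      | add p q hp hq => simp only [map_add, TensorProduct.add_tmul, hp, hq]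
      | tmul p q => simp [TensorProduct.smul_tmul']
    conv_lhs => rw [hf, e1, ← coassoc_apply, hz]
    simp only [map_sum, LinearMap.rTensor_tmul, e2, c]
  refine ⟨n, c, hv.isComatrix hc, ?_⟩
  have hx : x = ∑ i, counit (R := k) (a i) • v i := by
    have h := congrArg (TensorProduct.lid k C) (rTensor_counit_comul (R := k) x)
    rw [hz] at h
    simpa [map_sum] using h.symm
  rw [hx]
  exact Submodule.sum_mem _ fun i _ => Submodule.smul_mem _ _ (mem_span_of_comul_eq (hc i))

end Comatrix

/-! ### Direct sums of comatrix coalgebras -/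

section ComatrixSum

/-- The direct sum of the comatrix coalgebras of sizes `n i`, as the free module on the matrix units
`(i, a, b)` with `a b : Fin (n i)`. It is a type synonym so that it does not carry the coalgebra
structure of `Finsupp`, in which the basis vectors are group-like. -/
def ComatrixSum (k : Type*) [Field k] {ι : Type*} (n : ι → ℕ) : Type _ :=
  (Σ i, Fin (n i) × Fin (n i)) →₀ k

namespace ComatrixSum

open Coalgebra

variable {k : Type*} [Field k] {ι : Type*} {n : ι → ℕ}

instance : AddCommGroup (ComatrixSum k n) :=
  inferInstanceAs (AddCommGroup ((Σ i, Fin (n i) × Fin (n i)) →₀ k))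

instance : Module k (ComatrixSum k n) :=
  inferInstanceAs (Module k ((Σ i, Fin (n i) × Fin (n i)) →₀ k))

variable (k n) in
/-- The basis of matrix units. -/
def basis : Module.Basis (Σ i, Fin (n i) × Fin (n i)) k (ComatrixSum k n) :=
  Module.Basis.ofRepr (LinearEquiv.refl k ((Σ i, Fin (n i) × Fin (n i)) →₀ k))

variable (k n) in
/-- The matrix unit at position `(a, b)` in the `i`-th summand. -/
def unit (i : ι) (a b : Fin (n i)) : ComatrixSum k n := basis k n ⟨i, a, b⟩

theorem hom_ext {V : Type*} [AddCommGroup V] [Module k V] {f g : ComatrixSum k n →ₗ[k] V}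
    (h : ∀ i a b, f (unit k n i a b) = g (unit k n i a b)) : f = g :=
  (basis k n).ext fun p => h p.1 p.2.1 p.2.2

/-- The linear map with prescribed values on the matrix units. -/
def lift {V : Type*} [AddCommGroup V] [Module k V] (c : ∀ i, Fin (n i) → Fin (n i) → V) :
    ComatrixSum k n →ₗ[k] V :=
  (basis k n).constr k fun p => c p.1 p.2.1 p.2.2

@[simp]
theorem lift_unit {V : Type*} [AddCommGroup V] [Module k V] (c : ∀ i, Fin (n i) → Fin (n i) → V)
    (i : ι) (a b : Fin (n i)) : lift c (unit k n i a b) = c i a b :=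
  (basis k n).constr_basis k _ _

instance : CoalgebraStruct k (ComatrixSum k n) where
  comul := lift fun i a b => ∑ l, unit k n i a l ⊗ₜ unit k n i l b
  counit := lift fun _ a b => if a = b then 1 else 0

theorem comul_unit (i : ι) (a b : Fin (n i)) : comul (R := k) (unit k n i a b) =
    ∑ l, unit k n i a l ⊗ₜ unit k n i l b := lift_unit _ _ _ _

theorem counit_unit (i : ι) (a b : Fin (n i)) : counit (R := k) (unit k n i a b) =
    if a = b then 1 else 0 := lift_unit _ _ _ _

instance : Coalgebra k (ComatrixSum k n) where
  coassoc := hom_ext fun i a b => by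
    simp only [LinearMap.comp_apply, comul_unit, map_sum, LinearMap.rTensor_tmul,
      LinearMap.lTensor_tmul, TensorProduct.sum_tmul, TensorProduct.tmul_sum,
      LinearEquiv.coe_coe, TensorProduct.assoc_tmul]
    exact Finset.sum_comm
  rTensor_counit_comp_comul := hom_ext fun i a b => by
    simp [comul_unit, counit_unit, TensorProduct.ite_tmul]
  lTensor_counit_comp_comul := hom_ext fun i a b => by
    simp [comul_unit, counit_unit, TensorProduct.tmul_ite]

theorem isComatrix_unit (i : ι) : IsComatrix k (unit k n i) :=
  ⟨comul_unit i, counit_unit i⟩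

/-- The coalgebra map out of a sum of comatrix coalgebras given by a family of comatrices. -/
def liftCoalgHom {C : Type*} [AddCommGroup C] [Module k C] [Coalgebra k C]
    (c : ∀ i, Fin (n i) → Fin (n i) → C) (hc : ∀ i, IsComatrix k (c i)) :
    ComatrixSum k n →ₗc[k] C where
  toLinearMap := lift c
  counit_comp := hom_ext fun i a b => by simp [counit_unit, (hc i).counit_eq]
  map_comp_comul := hom_ext fun i a b => by simp [comul_unit, (hc i).comul_eq]

@[simp]
theorem liftCoalgHom_unit {C : Type*} [AddCommGroup C] [Module k C] [Coalgebra k C]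
    (c : ∀ i, Fin (n i) → Fin (n i) → C) (hc : ∀ i, IsComatrix k (c i))
    (i : ι) (a b : Fin (n i)) : liftCoalgHom c hc (unit k n i a b) = c i a b :=
  lift_unit c i a b

end ComatrixSum

end ComatrixSum

/-! ### The quotient by the largest coideal in the kernel of a linear map -/

section MaximalCoideal

open Coalgebra

variable {k C V : Type*} [Field k] [AddCommGroup C] [Module k C] [Coalgebra k C]
  [AddCommGroup V] [Module k V]

/-- The sum of all coideals contained in the kernel of `ψ`. -/
def maxCoideal (ψ : C →ₗ[k] V) : Submodule k C :=
  sSup {I : Submodule k C | I.IsCoideal ∧ I ≤ LinearMap.ker ψ}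

theorem maxCoideal_le_ker (ψ : C →ₗ[k] V) : maxCoideal ψ ≤ LinearMap.ker ψ :=
  sSup_le fun _ h => h.2

instance isCoideal_maxCoideal (ψ : C →ₗ[k] V) : (maxCoideal ψ).IsCoideal := by
  rw [Submodule.isCoideal_iff]
  have h : maxCoideal ψ ≤ LinearMap.ker (counit (R := k)) ⊓
      LinearMap.ker (TensorProduct.map (maxCoideal ψ).mkQ (maxCoideal ψ).mkQ ∘ₗ comul) := by
    refine sSup_le fun I hI x hx => ⟨hI.1.counit_eq_zero hx, ?_⟩
    have hle : I ≤ maxCoideal ψ := le_sSup hI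
    have hq : (maxCoideal ψ).mkQ = Submodule.factor hle ∘ₗ I.mkQ := rfl
    change TensorProduct.map (maxCoideal ψ).mkQ (maxCoideal ψ).mkQ (comul x) = 0
    rw [hq, TensorProduct.map_comp, LinearMap.comp_apply,
      hI.1.map_mkQ_comul_eq_zero hx, map_zero]
  exact ⟨fun x hx => (h hx).1, fun x hx => (h hx).2⟩

/-- The map induced by `ψ` on the quotient by the largest coideal in its kernel. -/
def maxCoidealLift (ψ : C →ₗ[k] V) : C ⧸ maxCoideal ψ →ₗ[k] V :=
  (maxCoideal ψ).liftQ ψ (maxCoideal_le_ker ψ)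

@[simp]
theorem maxCoidealLift_mk (ψ : C →ₗ[k] V) (x : C) :
    maxCoidealLift ψ (Submodule.Quotient.mk x) = ψ x := rfl

/-- Coalgebra maps into the quotient by the largest coideal in `ker ψ` are determined by their
composites with the map induced by `ψ`: the image of the difference of two such maps with equal
composites is a coideal, whose preimage in `C` is a coideal contained in `ker ψ`. -/
theorem coalgHom_ext_maxCoideal {N : Type*} [AddCommGroup N] [Module k N] [Coalgebra k N]
    {ψ : C →ₗ[k] V} {f g : N →ₗc[k] C ⧸ maxCoideal ψ}
    (h : ∀ n, maxCoidealLift ψ (f n) = maxCoidealLift ψ (g n)) : f = g := by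
  let I := maxCoideal ψ
  let d : N →ₗ[k] C ⧸ I := f - g
  let K : Submodule k C := (LinearMap.range d).comap I.mkQ
  have hIK : I ≤ K := fun x hx => by
    have : I.mkQ x = 0 := by simpa using hx
    simp [K, this]
  let q : C ⧸ I →ₗ[k] C ⧸ K := Submodule.factor hIK
  -- `K` contains `I`, and `f` and `g` become equal modulo `K`
  have hqd : q ∘ₗ d = 0 := by
    ext n
    obtain ⟨c, hc⟩ := I.mkQ_surjective (d n)
    rw [LinearMap.comp_apply, ← hc]
    change K.mkQ c = 0
    rw [Submodule.mkQ_apply, Submodule.Quotient.mk_eq_zero]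
    exact ⟨n, hc.symm⟩
  have hqfg : q ∘ₗ (f : N →ₗ[k] C ⧸ I) = q ∘ₗ (g : N →ₗ[k] C ⧸ I) := by
    rw [← sub_eq_zero, ← LinearMap.comp_sub]; exact hqd
  have hK : K.IsCoideal := by
    constructor
    · rintro x ⟨n, hn⟩
      rw [← Coalgebra.Quotient.counit_mk I, ← Submodule.mkQ_apply, ← hn]
      simp [d]
    · rintro x ⟨n, hn⟩
      have hq : K.mkQ = q ∘ₗ I.mkQ := rfl
      have e : TensorProduct.map I.mkQ I.mkQ (comul x) = comul (R := k) (I.mkQ x) := rfl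
      rw [hq, TensorProduct.map_comp, LinearMap.comp_apply, e, ← hn]
      simp only [d, LinearMap.sub_apply, map_sub, CoalgHom.coe_toLinearMap]
      rw [← CoalgHomClass.map_comp_comul_apply, ← CoalgHomClass.map_comp_comul_apply,
        ← LinearMap.comp_apply (TensorProduct.map q q),
        ← LinearMap.comp_apply (TensorProduct.map q q),
        ← TensorProduct.map_comp, ← TensorProduct.map_comp, hqfg, sub_self]
  have hKψ : K ≤ LinearMap.ker ψ := by
    rintro x ⟨n, hn⟩
    have : maxCoidealLift ψ (I.mkQ x) = 0 := by rw [← hn]; simp [d, h]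
    exact this
  have hKI : K ≤ I := le_sSup ⟨hK, hKψ⟩
  ext n
  obtain ⟨c, hc⟩ := I.mkQ_surjective (d n)
  have : c ∈ K := ⟨n, hc.symm⟩
  have h0 : d n = 0 := by
    rw [← hc, Submodule.mkQ_apply, Submodule.Quotient.mk_eq_zero]; exact hKI this
  exact sub_eq_zero.1 h0

/-- The kernel of a coalgebra map over a field is a coideal: the quotient by it embeds in the
target, and tensor squares of embeddings are embeddings. -/
theorem isCoideal_ker {D : Type*} [AddCommGroup D] [Module k D] [Coalgebra k D] (p : C →ₗc[k] D) :
    (LinearMap.ker (p : C →ₗ[k] D)).IsCoideal := by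
  set K := LinearMap.ker (p : C →ₗ[k] D) with hK
  constructor
  · intro x hx
    have hx : p x = 0 := hx
    rw [← CoalgHomClass.counit_comp_apply p, hx, map_zero]
  · intro x hx
    have hx : p x = 0 := hx
    let i : C ⧸ K →ₗ[k] D := K.liftQ p le_rfl
    have hi : Function.Injective i := LinearMap.ker_eq_bot.1 (Submodule.ker_liftQ_eq_bot' _ _ rfl)
    have hip : i ∘ₗ K.mkQ = p := K.liftQ_mkQ _ _
    refine TensorProduct.map_injective_of_flat_flat i i hi hi ?_
    rw [← LinearMap.comp_apply, ← TensorProduct.map_comp, hip, CoalgHomClass.map_comp_comul_apply,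
      hx, map_zero, map_zero]

/-- The quotient of `C` by the largest coideal in `ker ψ` is terminal among the quotient coalgebras
of `C` through which `ψ` factors. -/
theorem exists_coalgHom_maxCoideal {D : Type*} [AddCommGroup D] [Module k D] [Coalgebra k D]
    (p : C →ₗc[k] D) (hp : Function.Surjective p) {ψ : C →ₗ[k] V} (χ : D →ₗ[k] V)
    (hχ : ∀ x, χ (p x) = ψ x) :
    ∃ φ : D →ₗc[k] C ⧸ maxCoideal ψ, ∀ x, φ (p x) = Submodule.Quotient.mk x := by
  have hle : LinearMap.ker (p : C →ₗ[k] D) ≤ maxCoideal ψ :=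
    le_sSup ⟨isCoideal_ker p, fun x (hx : p x = 0) => by
      rw [LinearMap.mem_ker, ← hχ, hx, map_zero]⟩
  let e := (p : C →ₗ[k] D).quotKerEquivOfSurjective hp
  let φ : D →ₗ[k] C ⧸ maxCoideal ψ := Submodule.factor hle ∘ₗ e.symm.toLinearMap
  have hφ : ∀ x, φ (p x) = Submodule.Quotient.mk x := fun x => by
    have : e.symm (p x) = Submodule.Quotient.mk x := by
      rw [LinearEquiv.symm_apply_eq]; rfl
    simp only [φ, LinearMap.comp_apply, LinearEquiv.coe_coe, this]
    rfl
  have hφp : φ ∘ₗ (p : C →ₗ[k] D) = (maxCoideal ψ).mkQ := LinearMap.ext hφ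
  refine ⟨⟨φ, ?_, ?_⟩, hφ⟩
  · refine LinearMap.ext fun y => ?_
    obtain ⟨x, rfl⟩ := hp y
    rw [LinearMap.comp_apply, hφ, Coalgebra.Quotient.counit_mk, CoalgHomClass.counit_comp_apply]
  · refine LinearMap.ext fun y => ?_
    obtain ⟨x, rfl⟩ := hp y
    rw [LinearMap.comp_apply, LinearMap.comp_apply, hφ, Coalgebra.Quotient.comul_mk,
      ← CoalgHomClass.map_comp_comul_apply, ← LinearMap.comp_apply, ← TensorProduct.map_comp, hφp]

end MaximalCoideal

/-! ### Inclusions into a direct sum of two coalgebras -/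

section ProdCoalgHom

variable (k C D : Type*) [Field k] [AddCommGroup C] [Module k C] [Coalgebra k C]
  [AddCommGroup D] [Module k D] [Coalgebra k D]

/-- The left inclusion into a direct sum of coalgebras, as a coalgebra map. -/
def CoalgHom.inl : C →ₗc[k] C × D :=
  ⟨LinearMap.inl k C D, Prod.counit_comp_inl k C D, (Prod.comul_comp_inl k C D).symm⟩

/-- The right inclusion into a direct sum of coalgebras, as a coalgebra map. -/
def CoalgHom.inr : D →ₗc[k] C × D :=
  ⟨LinearMap.inr k C D, Prod.counit_comp_inr k C D, (Prod.comul_comp_inr k C D).symm⟩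

end ProdCoalgHom

/-! ### The universal measuring coalgebra -/

section UniversalMeasuring

open Coalgebra

/-- `θ : M × T → A` is a universal measuring: every measuring `N × T → A` by a coalgebra `N` is
`θ(φ(-), -)` for a unique coalgebra map `φ : N → M`. -/
structure IsUniversalMeasuring {k T A M : Type u} [Field k] [Ring T] [Algebra k T] [Ring A]
    [Algebra k A] [AddCommGroup M] [Module k M] [Coalgebra k M] (θ : M →ₗ[k] T →ₗ[k] A) : Prop where
  isMeasuring : IsMeasuring θ
  exists_lift : ∀ (N : Type u) [AddCommGroup N] [Module k N] [Coalgebra k N]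
    (f : N →ₗ[k] T →ₗ[k] A), IsMeasuring f → ∃ φ : N →ₗc[k] M, ∀ n, θ (φ n) = f n
  hom_ext : ∀ (N : Type u) [AddCommGroup N] [Module k N] [Coalgebra k N]
    (φ φ' : N →ₗc[k] M), (∀ n, θ (φ n) = θ (φ' n)) → φ = φ'

variable {k T A : Type*} [Field k] [Ring T] [Algebra k T] [Ring A] [Algebra k A]

theorem IsMeasuring.comp_coalgHom {N N' : Type*} [AddCommGroup N] [Module k N] [Coalgebra k N]
    [AddCommGroup N'] [Module k N'] [Coalgebra k N'] {f : N →ₗ[k] T →ₗ[k] A}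
    (hf : IsMeasuring f) (φ : N' →ₗc[k] N) : IsMeasuring (f ∘ₗ (φ : N' →ₗ[k] N)) := by
  have hflip : ∀ t, (f ∘ₗ (φ : N' →ₗ[k] N)).flip t = f.flip t ∘ₗ (φ : N' →ₗ[k] N) := fun _ => rfl
  constructor
  · intro n t t'
    rw [hflip, hflip, TensorProduct.map_comp, LinearMap.comp_apply (TensorProduct.map _ _),
      CoalgHomClass.map_comp_comul_apply]
    exact hf.map_mul _ _ _
  · intro n
    simp [hf.map_one]

theorem isMeasuring_of_comp_surjective {N N' : Type*} [AddCommGroup N] [Module k N] [Coalgebra k N]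
    [AddCommGroup N'] [Module k N'] [Coalgebra k N'] {f : N →ₗ[k] T →ₗ[k] A}
    (φ : N' →ₗc[k] N) (hφ : Function.Surjective φ)
    (hf : IsMeasuring (f ∘ₗ (φ : N' →ₗ[k] N))) : IsMeasuring f := by
  have hflip : ∀ t, (f ∘ₗ (φ : N' →ₗ[k] N)).flip t = f.flip t ∘ₗ (φ : N' →ₗ[k] N) := fun _ => rfl
  constructor
  · intro n t t'
    obtain ⟨n, rfl⟩ := hφ n
    rw [← CoalgHomClass.map_comp_comul_apply, ← LinearMap.comp_apply (TensorProduct.map _ _),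
      ← TensorProduct.map_comp]
    exact hf.map_mul _ _ _
  · intro n
    obtain ⟨n, rfl⟩ := hφ n
    simpa using hf.map_one n

/-- A measuring restricts along a comatrix to a matrix representation of the algebra measured. -/
def IsMeasuring.matrixRep {N : Type*} [AddCommGroup N] [Module k N] [Coalgebra k N]
    {f : N →ₗ[k] T →ₗ[k] A} (hf : IsMeasuring f) {n : ℕ} {c : Fin n → Fin n → N}
    (hc : IsComatrix k c) : T →ₐ[k] Matrix (Fin n) (Fin n) A :=
  AlgHom.ofLinearMap
    { toFun := fun t => Matrix.of fun i j => f (c i j) t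
      map_add' := fun t t' => by ext; simp
      map_smul' := fun a t => by ext; simp }
    (by
      ext i j
      simp [hf.map_one, hc.counit_eq, Matrix.one_apply, apply_ite (algebraMap k A)])
    (fun t t' => by
      ext i j
      simp [hf.map_mul, hc.comul_eq, Matrix.mul_apply])

variable (k T A) in
/-- The tautological pairing of `T` with the sum of the comatrix coalgebras indexed by all matrix
representations of `T` over `A`. -/
def repPairing :
    ComatrixSum k (fun ρ : Σ n : ℕ, T →ₐ[k] Matrix (Fin n) (Fin n) A => ρ.1) →ₗ[k] T →ₗ[k] A :=
  ComatrixSum.lift fun ρ i j => Matrix.entryLinearMap k A i j ∘ₗ ρ.2.toLinearMap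

/-- Being a measuring says that the matrix representations are multiplicative and unital. -/
theorem isMeasuring_repPairing : IsMeasuring (repPairing k T A) := by
  constructor
  · intro c t t'
    refine LinearMap.congr_fun (f := (repPairing k T A).flip (t * t'))
      (g := LinearMap.mul' k A ∘ₗ TensorProduct.map ((repPairing k T A).flip t)
        ((repPairing k T A).flip t') ∘ₗ comul) (ComatrixSum.hom_ext fun ρ i j => ?_) c
    simp [repPairing, ComatrixSum.comul_unit, Matrix.mul_apply]
  · intro c
    refine LinearMap.congr_fun (f := (repPairing k T A).flip 1)
      (g := Algebra.linearMap k A ∘ₗ counit) (ComatrixSum.hom_ext fun ρ i j => ?_) c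
    simp [repPairing, ComatrixSum.counit_unit, Matrix.one_apply, apply_ite (algebraMap k A)]

theorem IsMeasuring.coprod {N N' : Type*} [AddCommGroup N] [Module k N] [Coalgebra k N]
    [AddCommGroup N'] [Module k N'] [Coalgebra k N'] {f : N →ₗ[k] T →ₗ[k] A}
    {f' : N' →ₗ[k] T →ₗ[k] A} (hf : IsMeasuring f) (hf' : IsMeasuring f') :
    IsMeasuring (f.coprod f') := by
  have h1 : ∀ t, (f.coprod f').flip t ∘ₗ LinearMap.inl k N N' = f.flip t := fun t => by
    ext; simp
  have h2 : ∀ t, (f.coprod f').flip t ∘ₗ LinearMap.inr k N N' = f'.flip t := fun t => by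
    ext; simp
  constructor
  · rintro ⟨n, n'⟩ t t'
    rw [Prod.comul_apply, map_add, map_add, ← LinearMap.comp_apply (TensorProduct.map _ _),
      ← LinearMap.comp_apply (TensorProduct.map _ _), ← TensorProduct.map_comp,
      ← TensorProduct.map_comp, h1, h1, h2, h2, ← hf.map_mul, ← hf'.map_mul]
    simp
  · rintro ⟨n, n'⟩
    simp [hf.map_one, hf'.map_one]

/-- The universal measuring coalgebra is the sum of the comatrix coalgebras of all matrix
representations of `T` over `A`, divided by the largest coideal on which the tautological pairing
vanishes. -/
theorem isUniversalMeasuring_maxCoidealLift_repPairing {k T A : Type u} [Field k] [Ring T]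
    [Algebra k T] [Ring A] [Algebra k A] :
    IsUniversalMeasuring (maxCoidealLift (repPairing k T A)) := by
  let π := Coalgebra.Quotient.mkQCoalgHom (maxCoideal (repPairing k T A))
  have hπ : Function.Surjective π := Submodule.mkQ_surjective _
  refine ⟨isMeasuring_of_comp_surjective π hπ isMeasuring_repPairing, ?_,
    fun N _ _ _ φ φ' h => coalgHom_ext_maxCoideal h⟩
  intro N _ _ _ f hf
  -- `N` is glued to the sum of comatrix coalgebras; in the quotient `Q` of the result every element
  -- of `N` becomes identified with an element of that sum.
  let ψ := f.coprod (repPairing k T A)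
  let Q := _ ⧸ maxCoideal ψ
  let p := Coalgebra.Quotient.mkQCoalgHom (maxCoideal ψ)
  let iN : N →ₗc[k] Q := p.comp (CoalgHom.inl k N _)
  let iC : _ →ₗc[k] Q := p.comp (CoalgHom.inr k N _)
  have hiN : ∀ x, maxCoidealLift ψ (iN x) = f x := fun x => by
    change ψ (x, 0) = f x
    simp [ψ]
  have hiC : ∀ x, maxCoidealLift ψ (iC x) = repPairing k T A x := fun x => by
    change ψ (0, x) = repPairing k T A x
    simp [ψ]
  have hrange : ∀ x, iN x ∈ LinearMap.range iC.toLinearMap := by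
    intro x
    obtain ⟨n, c, hc, hx⟩ := exists_isComatrix_mem_span (k := k) x
    -- the matrix units of the representation attached to `c` pair with `T` like the entries of `c`
    have key : ∀ i j, iN (c i j) = iC (ComatrixSum.unit k _ ⟨n, hf.matrixRep hc⟩ i j) := by
      intro i j
      let c₁ := ComatrixSum.liftCoalgHom (k := k) (n := fun _ : Unit => n) (fun _ => c) fun _ => hc
      let c₂ := ComatrixSum.liftCoalgHom (k := k) (n := fun _ : Unit => n)
        (fun _ => ComatrixSum.unit k (fun ρ : Σ n : ℕ, T →ₐ[k] Matrix (Fin n) (Fin n) A => ρ.1)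
          ⟨n, hf.matrixRep hc⟩) fun _ => ComatrixSum.isComatrix_unit _
      have : iN.comp c₁ = iC.comp c₂ := by
        refine coalgHom_ext_maxCoideal fun d => LinearMap.congr_fun
          (f := maxCoidealLift ψ ∘ₗ (iN.comp c₁ : _ →ₗ[k] Q))
          (g := maxCoidealLift ψ ∘ₗ (iC.comp c₂ : _ →ₗ[k] Q))
          (ComatrixSum.hom_ext fun u i j => ?_) d
        ext t
        simp [c₁, c₂, hiN, hiC, repPairing, IsMeasuring.matrixRep]
      simpa [c₁, c₂] using CoalgHom.congr_fun this (ComatrixSum.unit k _ () i j)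
    induction hx using Submodule.span_induction with
    | mem x hx =>
      obtain ⟨⟨i, j⟩, rfl⟩ := hx
      exact ⟨_, (key i j).symm⟩
    | zero => rw [map_zero]; exact zero_mem _
    | add x y _ _ hx hy => rw [map_add]; exact add_mem hx hy
    | smul a x _ hx => rw [map_smul]; exact Submodule.smul_mem _ a hx
  have hsurj : Function.Surjective iC := by
    intro y
    obtain ⟨⟨x, z⟩, rfl⟩ := Submodule.mkQ_surjective _ y
    obtain ⟨w, hw⟩ := hrange x
    refine ⟨w + z, ?_⟩
    have : (x, z) = CoalgHom.inl k N _ x + CoalgHom.inr k N _ z := by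
      simp [CoalgHom.inl, CoalgHom.inr]
    rw [this, map_add, map_add]
    exact congrArg (· + iC z) hw
  obtain ⟨φ, hφ⟩ := exists_coalgHom_maxCoideal iC hsurj (maxCoidealLift ψ) hiC
  refine ⟨φ.comp iN, fun x => ?_⟩
  obtain ⟨w, hw⟩ := hsurj (iN x)
  rw [CoalgHom.coe_comp, Function.comp_apply, ← hw, hφ, maxCoidealLift_mk, ← hiC, hw, hiN]

end UniversalMeasuring

/-! ### Products of measurings -/

section TensorPairing

open Coalgebra

variable {k T S A N N' : Type*} [Field k] [CommRing A] [Algebra k A]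

/-- The pairing `(n ⊗ n', t ⊗ s) ↦ f(n, t) g(n', s)`. -/
def tensorPairing [AddCommGroup N] [Module k N] [AddCommGroup N'] [Module k N'] [AddCommGroup T]
    [Module k T] [AddCommGroup S] [Module k S] (f : N →ₗ[k] T →ₗ[k] A) (g : N' →ₗ[k] S →ₗ[k] A) :
    N ⊗[k] N' →ₗ[k] T ⊗[k] S →ₗ[k] A :=
  LinearMap.compRight k (LinearMap.mul' k A) ∘ₗ
    TensorProduct.homTensorHomMap (RingHom.id k) T S A A ∘ₗ TensorProduct.map f g

@[simp]
theorem tensorPairing_tmul [AddCommGroup N] [Module k N] [AddCommGroup N'] [Module k N']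
    [AddCommGroup T] [Module k T] [AddCommGroup S] [Module k S] (f : N →ₗ[k] T →ₗ[k] A)
    (g : N' →ₗ[k] S →ₗ[k] A) (n : N) (n' : N') (t : T) (s : S) :
    tensorPairing f g (n ⊗ₜ n') (t ⊗ₜ s) = f n t * g n' s := rfl

theorem tensorPairing_flip [AddCommGroup N] [Module k N] [AddCommGroup N'] [Module k N']
    [AddCommGroup T] [Module k T] [AddCommGroup S] [Module k S] (f : N →ₗ[k] T →ₗ[k] A)
    (g : N' →ₗ[k] S →ₗ[k] A) : (tensorPairing f g).flip = tensorPairing f.flip g.flip := by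
  ext; simp

/-- The product of two measurings with values in a commutative algebra is a measuring. -/
theorem IsMeasuring.tensorPairing [AddCommGroup N] [Module k N] [Coalgebra k N]
    [AddCommGroup N'] [Module k N'] [Coalgebra k N'] [Ring T] [Algebra k T] [Ring S] [Algebra k S]
    {f : N →ₗ[k] T →ₗ[k] A} {g : N' →ₗ[k] S →ₗ[k] A} (hf : IsMeasuring f) (hg : IsMeasuring g) :
    IsMeasuring (tensorPairing f g) := by
  constructor
  · intro c b b'
    induction c with
    | zero => simp
    | add x y hx hy => simp only [map_add, LinearMap.add_apply, hx, hy]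
    | tmul n n' =>
    induction b with
    | zero => simp
    | add x y hx hy =>
      simp only [add_mul, map_add, hx, hy, TensorProduct.map_add_left, LinearMap.add_apply]
    | tmul t s =>
    induction b' with
    | zero => simp
    | add x y hx hy =>
      simp only [mul_add, map_add, hx, hy, TensorProduct.map_add_right, LinearMap.add_apply]
    | tmul t' s' =>
    rw [Algebra.TensorProduct.tmul_mul_tmul, tensorPairing_tmul, hf.map_mul, hg.map_mul,
      TensorProduct.comul_tmul]
    induction comul (R := k) n with
    | zero => simp
    | add x y hx hy => simp only [TensorProduct.add_tmul, map_add, add_mul, hx, hy]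
    | tmul n₁ n₂ =>
    induction comul (R := k) n' with
    | zero => simp
    | add x y hx hy => simp only [TensorProduct.tmul_add, map_add, mul_add, hx, hy]
    | tmul n₁' n₂' => simp [mul_mul_mul_comm]
  · intro c
    induction c with
    | zero => simp
    | add x y hx hy => simp only [map_add, LinearMap.add_apply, hx, hy]
    | tmul n n' =>
      rw [Algebra.TensorProduct.one_def, tensorPairing_tmul, hf.map_one, hg.map_one]
      simp [mul_comm]

theorem IsMeasuring.compl₂_algHom [AddCommGroup N] [Module k N] [Coalgebra k N]
    [Ring T] [Algebra k T] [Ring S] [Algebra k S]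
    {f : N →ₗ[k] T →ₗ[k] A} (hf : IsMeasuring f) (φ : S →ₐ[k] T) :
    IsMeasuring (f.compl₂ φ.toLinearMap) := by
  constructor
  · intro c b b'
    rw [LinearMap.compl₂_apply, AlgHom.toLinearMap_apply, _root_.map_mul]
    exact hf.map_mul c (φ b) (φ b')
  · intro c
    simpa using hf.map_one c

variable [Ring N] [Bialgebra k N] [Ring N'] [Bialgebra k N'] [Ring T] [Bialgebra k T]
  [Ring S] [Bialgebra k S]

theorem IsBimeasuring.tensorPairing {f : N →ₗ[k] T →ₗ[k] A} {g : N' →ₗ[k] S →ₗ[k] A}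
    (hf : IsBimeasuring f) (hg : IsBimeasuring g) : IsBimeasuring (tensorPairing f g) :=
  ⟨hf.left.tensorPairing hg.left, by
    rw [tensorPairing_flip]; exact hf.right.tensorPairing hg.right⟩

theorem IsBimeasuring.comp_bialgHom {f : N →ₗ[k] T →ₗ[k] A} (hf : IsBimeasuring f)
    (φ : N' →ₐc[k] N) : IsBimeasuring (f ∘ₗ (φ : N' →ₗ[k] N)) :=
  ⟨hf.left.comp_coalgHom (φ : N' →ₗc[k] N), hf.right.compl₂_algHom (φ : N' →ₐ[k] N)⟩

theorem IsBimeasuring.compl₂_bialgHom {f : N →ₗ[k] T →ₗ[k] A} (hf : IsBimeasuring f)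
    (φ : S →ₐc[k] T) : IsBimeasuring (f.compl₂ (φ : S →ₗ[k] T)) :=
  ⟨hf.left.compl₂_algHom (φ : S →ₐ[k] T), hf.right.comp_coalgHom (φ : S →ₗc[k] T)⟩

end TensorPairing

/-! ### The universal bimeasuring bialgebra -/

section Bialgebra

open Coalgebra WithConv

/-- An algebra with a coalgebra structure is a bialgebra if its multiplication and its unit are
coalgebra maps. -/
@[reducible]
def Bialgebra.ofCoalgHom {k M : Type*} [Field k] [Ring M] [Algebra k M] [Coalgebra k M]
    (μ : M ⊗[k] M →ₗc[k] M) (hμ : ∀ x y, μ (x ⊗ₜ y) = x * y) (η : k →ₗc[k] M) (hη : η 1 = 1) :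
    Bialgebra k M :=
  Bialgebra.mk' k M
    (by rw [← hη, CoalgHomClass.counit_comp_apply, CommSemiring.counit_apply])
    (fun {x y} => by
      rw [← hμ, CoalgHomClass.counit_comp_apply, TensorProduct.counit_tmul, smul_eq_mul, mul_comm])
    (by
      rw [← hη, ← CoalgHomClass.map_comp_comul_apply, CommSemiring.comul_apply,
        _root_.TensorProduct.map_tmul]
      simp [hη, Algebra.TensorProduct.one_def])
    (fun {x y} => by
      rw [← hμ, ← CoalgHomClass.map_comp_comul_apply, TensorProduct.comul_tmul]
      induction comul (R := k) x with
      | zero => simp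
      | add p q hp hq => simp only [TensorProduct.add_tmul, map_add, add_mul, hp, hq]
      | tmul x₁ x₂ =>
      induction comul (R := k) y with
      | zero => simp
      | add p q hp hq => simp only [TensorProduct.tmul_add, map_add, mul_add, hp, hq]
      | tmul y₁ y₂ => simp [hμ])

/-- If `T` is a bialgebra and `A` is commutative, the convolution product of `T → A` induces a
multiplication on the universal measuring coalgebra, which thereby becomes the universal
bimeasuring bialgebra. -/
theorem IsUniversalMeasuring.exists_isUniversalBimeasuring {k T A M : Type u} [Field k]
    [Ring T] [Bialgebra k T]
    [CommRing A] [Algebra k A] [AddCommGroup M] [Module k M] [Coalgebra k M]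
    {θ : M →ₗ[k] T →ₗ[k] A} (hθ : IsUniversalMeasuring θ) :
    ∃ (B : Type u) (_ : Ring B) (_ : Bialgebra k B) (θ : B →ₗ[k] T →ₗ[k] A),
      IsUniversalBimeasuring θ ∧ IsUniversalMeasuring θ := by
  obtain ⟨μ, hμ⟩ := hθ.exists_lift (M ⊗[k] M)
    ((tensorPairing θ θ).compl₂ (Bialgebra.comulAlgHom k T).toLinearMap)
    ((hθ.isMeasuring.tensorPairing hθ.isMeasuring).compl₂_algHom _)
  obtain ⟨η, hη⟩ := hθ.exists_lift k
    (LinearMap.toSpanSingleton k (T →ₗ[k] A) (Algebra.linearMap k A ∘ₗ counit))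
    ⟨fun c t t' => by simp, fun c => by simp [Algebra.algebraMap_eq_smul_one]⟩
  -- `Θ` takes values in the convolution ring, whose ring laws become those of `μ` and `η` by the
  -- uniqueness of lifts
  let Θ : M → WithConv (T →ₗ[k] A) := fun m => toConv (θ m)
  have hΘμ : ∀ x y, Θ (μ (x ⊗ₜ y)) = Θ x * Θ y := fun x y => by
    simp only [Θ, hμ]; rfl
  have hΘη : Θ (η 1) = 1 := by
    simp only [Θ, hη, LinearMap.toSpanSingleton_apply, one_smul]; rfl
  have hone : ∀ x, μ (η 1 ⊗ₜ x) = x := by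
    let f : M →ₗc[k] M := (μ.comp (Coalgebra.TensorProduct.map η (CoalgHom.id k M))).comp
      (Coalgebra.TensorProduct.lid k M).symm
    have hf : ∀ x, f x = μ (η 1 ⊗ₜ x) := fun x => rfl
    have : f = CoalgHom.id k M := hθ.hom_ext M _ _ fun x => by
      have : Θ (f x) = Θ x := by rw [hf, hΘμ, hΘη, one_mul]
      exact congrArg ofConv this
    intro x
    rw [← hf, this]; rfl
  have hone' : ∀ x, μ (x ⊗ₜ η 1) = x := by
    let f : M →ₗc[k] M := (μ.comp (Coalgebra.TensorProduct.map (CoalgHom.id k M) η)).comp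
      (Coalgebra.TensorProduct.rid k k M).symm
    have hf : ∀ x, f x = μ (x ⊗ₜ η 1) := fun x => rfl
    have : f = CoalgHom.id k M := hθ.hom_ext M _ _ fun x => by
      have : Θ (f x) = Θ x := by rw [hf, hΘμ, hΘη, mul_one]
      exact congrArg ofConv this
    intro x
    rw [← hf, this]; rfl
  have hassoc : ∀ x y z, μ (μ (x ⊗ₜ y) ⊗ₜ z) = μ (x ⊗ₜ μ (y ⊗ₜ z)) := by
    let f := μ.comp (Coalgebra.TensorProduct.map μ (CoalgHom.id k M))
    let g := (μ.comp (Coalgebra.TensorProduct.map (CoalgHom.id k M) μ)).comp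
      (Coalgebra.TensorProduct.assoc k k M M M : (M ⊗[k] M) ⊗[k] M →ₗc[k] M ⊗[k] (M ⊗[k] M))
    have hf : ∀ x y z, f ((x ⊗ₜ y) ⊗ₜ z) = μ (μ (x ⊗ₜ y) ⊗ₜ z) := fun _ _ _ => rfl
    have hg : ∀ x y z, g ((x ⊗ₜ y) ⊗ₜ z) = μ (x ⊗ₜ μ (y ⊗ₜ z)) := fun _ _ _ => rfl
    have : f = g := hθ.hom_ext _ _ _ fun w => by
      refine LinearMap.congr_fun (f := θ ∘ₗ f.toLinearMap) (g := θ ∘ₗ g.toLinearMap)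
        (TensorProduct.ext_threefold fun x y z => ?_) w
      have : Θ (f ((x ⊗ₜ y) ⊗ₜ z)) = Θ (g ((x ⊗ₜ y) ⊗ₜ z)) := by
        rw [hf, hg, hΘμ, hΘμ, hΘμ, hΘμ, mul_assoc]
      exact congrArg ofConv this
    intro x y z
    rw [← hf, ← hg, this]
  have hsmul : ∀ (r : k) (x y : M), μ ((r • x) ⊗ₜ y) = r • μ (x ⊗ₜ y) := fun r x y => by
    rw [← map_smul, TensorProduct.smul_tmul']
  have hsmul' : ∀ (r : k) (x y : M), μ (x ⊗ₜ (r • y)) = r • μ (x ⊗ₜ y) := fun r x y => by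
    rw [← map_smul, TensorProduct.tmul_smul]
  let : Ring M :=
    { (inferInstance : AddCommGroup M) with
      mul := fun x y => μ (x ⊗ₜ y)
      one := η 1
      mul_assoc := hassoc
      one_mul := hone
      mul_one := hone'
      left_distrib := fun x y z => by
        change μ (x ⊗ₜ (y + z)) = μ (x ⊗ₜ y) + μ (x ⊗ₜ z)
        rw [TensorProduct.tmul_add, map_add]
      right_distrib := fun x y z => by
        change μ ((x + y) ⊗ₜ z) = μ (x ⊗ₜ z) + μ (y ⊗ₜ z)
        rw [TensorProduct.add_tmul, map_add]
      zero_mul := fun x => by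
        change μ (0 ⊗ₜ x) = 0
        rw [TensorProduct.zero_tmul, map_zero]
      mul_zero := fun x => by
        change μ (x ⊗ₜ 0) = 0
        rw [TensorProduct.tmul_zero, map_zero] }
  have hmul : ∀ x y : M, x * y = μ (x ⊗ₜ y) := fun _ _ => rfl
  have h1 : (1 : M) = η 1 := rfl
  let : Algebra k M := Algebra.ofModule
    hsmul
    hsmul'
  let : Bialgebra k M := Bialgebra.ofCoalgHom μ (fun _ _ => rfl) η rfl
  refine ⟨M, inferInstance, inferInstance, θ, ⟨⟨hθ.isMeasuring, ?_, ?_⟩, ?_⟩, hθ⟩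
  · intro t x y
    exact LinearMap.congr_fun (congrArg ofConv (hΘμ x y)) t
  · intro t
    exact LinearMap.congr_fun (congrArg ofConv hΘη) t
  · intro N _ _ f hf
    obtain ⟨φ, hφ⟩ := hθ.exists_lift N f hf.left
    -- `φ` is multiplicative, as `f` measures `N` through the convolution product of `T → A`
    have hφ1 : φ 1 = 1 := by
      have : φ.comp (Bialgebra.unitBialgHom k N : k →ₗc[k] N) = η := hθ.hom_ext k _ _ fun c => by
        refine LinearMap.congr_fun (f := θ ∘ₗ (φ.comp (Bialgebra.unitBialgHom k N)).toLinearMap)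
          (g := θ ∘ₗ η.toLinearMap) (LinearMap.ext_ring ?_) c
        ext t
        have e1 : θ (η 1) t = algebraMap k A (counit t) :=
          LinearMap.congr_fun (congrArg ofConv hΘη) t
        have e2 : θ (φ 1) t = algebraMap k A (counit t) := by
          rw [hφ]; exact hf.right.map_one t
        have e3 : Bialgebra.unitBialgHom k N 1 = 1 := map_one _
        change θ (φ (Bialgebra.unitBialgHom k N 1)) t = θ (η 1) t
        rw [e3, e1, e2]
      have h := CoalgHom.congr_fun this 1
      rw [CoalgHom.coe_comp, Function.comp_apply] at h
      rw [← map_one (Bialgebra.unitBialgHom k N)]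
      exact h
    have hφmul : ∀ x y, φ (x * y) = φ x * φ y := by
      have : φ.comp (Bialgebra.mulCoalgHom k N) =
          μ.comp (Coalgebra.TensorProduct.map φ φ) := hθ.hom_ext _ _ _ fun w => by
        refine LinearMap.congr_fun (f := θ ∘ₗ (φ.comp (Bialgebra.mulCoalgHom k N)).toLinearMap)
          (g := θ ∘ₗ (μ.comp (Coalgebra.TensorProduct.map φ φ)).toLinearMap)
          (TensorProduct.ext' fun x y => ?_) w
        ext t
        have e1 : θ (μ (φ x ⊗ₜ φ y)) t = LinearMap.mul' k A
            (TensorProduct.map (θ (φ x)) (θ (φ y)) (comul t)) :=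
          LinearMap.congr_fun (congrArg ofConv (hΘμ (φ x) (φ y))) t
        change θ (φ (x * y)) t = θ (μ (φ x ⊗ₜ φ y)) t
        rw [e1, hφ, hφ, hφ]
        exact hf.right.map_mul t x y
      exact fun x y => CoalgHom.congr_fun this (x ⊗ₜ y)
    refine ⟨{ φ with map_one' := hφ1, map_mul' := hφmul },
      fun n t => LinearMap.congr_fun (hφ n) t, ?_⟩
    intro ψ hψ
    have := hθ.hom_ext N (ψ : N →ₗc[k] M) φ fun n => by
      ext t
      rw [hφ, ← hψ]; rfl
    ext n
    exact CoalgHom.congr_fun this n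

theorem hasUniversalBimeasuring {k T A : Type u} [Field k] [Ring T] [Bialgebra k T]
    [CommRing A] [Algebra k A] : HasUniversalBimeasuring k T A := by
  obtain ⟨B, _, _, θ, hθ, -⟩ :=
    (isUniversalMeasuring_maxCoidealLift_repPairing (k := k) (T := T)
      (A := A)).exists_isUniversalBimeasuring
  exact ⟨B, _, _, θ, hθ⟩

/-- Coalgebra maps, and not only bialgebra maps, into a universal bimeasuring bialgebra are
determined by the induced pairings, since that bialgebra is isomorphic to the universal measuring
coalgebra. -/
theorem IsUniversalBimeasuring.coalgHom_ext {k T A B : Type u} [Field k] [Ring T] [Bialgebra k T]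
    [CommRing A] [Algebra k A] [Ring B] [Bialgebra k B] {θ : B →ₗ[k] T →ₗ[k] A}
    (hθ : IsUniversalBimeasuring θ) {N : Type u} [AddCommGroup N] [Module k N] [Coalgebra k N]
    {φ φ' : N →ₗc[k] B} (h : ∀ n t, θ (φ n) t = θ (φ' n) t) : φ = φ' := by
  obtain ⟨M, _, _, θM, hM, hM'⟩ :=
    (isUniversalMeasuring_maxCoidealLift_repPairing (k := k) (T := T)
      (A := A)).exists_isUniversalBimeasuring
  obtain ⟨p, hp, -⟩ := hM.existsUnique_lift B θ hθ.isBimeasuring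
  obtain ⟨q, hq, -⟩ := hθ.existsUnique_lift M θM hM.isBimeasuring
  have hqp : q.comp p = BialgHom.id k B :=
    (hθ.existsUnique_lift B θ hθ.isBimeasuring).unique (fun b t => by simp [hp, hq])
      (fun b t => by simp)
  have hpφ : (p : B →ₗc[k] M).comp φ = (p : B →ₗc[k] M).comp φ' :=
    hM'.hom_ext N _ _ fun n => by
      ext t
      simpa [hp] using h n t
  ext n
  have hb : ∀ b, q (p b) = b := fun b => BialgHom.congr_fun hqp b
  rw [← hb (φ n), ← hb (φ' n)]
  exact congrArg q (CoalgHom.congr_fun hpφ n)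

end Bialgebra

/-! ### The cocommutative part as a coreflection -/

section CocommPart

open Coalgebra

variable {k H N : Type*} [Field k] [Ring H] [Bialgebra k H]

variable (k H) in
/-- The inclusion of the cocommutative part, as a bialgebra map. -/
def cocommPartIncl : cocommPart k H →ₐc[k] H :=
  BialgHom.ofAlgHom (cocommPart k H).val rfl
    (AlgHom.toLinearMap_injective (map_val_comp_cocommPartComul k))

/-- The comultiplication of `H_c` is symmetric because that of `H` is symmetric on `H_c` and
`H_c ⊗ H_c` embeds in `H ⊗ H`. -/
instance isCocomm_cocommPart : IsCocomm k (cocommPart k H) where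
  comm_comp_comul := by
    refine LinearMap.ext fun x => cocommPartTensorIncl_injective k ?_
    have hcomm : ∀ z, cocommPartTensorIncl k H (TensorProduct.comm k _ _ z) =
        TensorProduct.comm k H H (cocommPartTensorIncl k H z) := fun z => by
      induction z with
      | zero => simp
      | add p q hp hq => simp only [map_add, hp, hq]
      | tmul p q => rfl
    have hx : cocommPartTensorIncl k H (comul x) = comul (R := k) (x : H) :=
      cocommPartTensorIncl_comul k x
    change cocommPartTensorIncl k H (TensorProduct.comm k _ _ (comul x)) = _
    rw [hcomm, hx]
    exact (isCocommSubcoalgebra_cocommSubmodule k (x : H) x.2).2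

/-- The image of a cocommutative coalgebra is a cocommutative subcoalgebra. -/
theorem coalgHom_mem_cocommPart [AddCommGroup N] [Module k N] [Coalgebra k N] [IsCocomm k N]
    (φ : N →ₗc[k] H) (n : N) : φ n ∈ cocommPart k H := by
  have h : IsCocommSubcoalgebra k (LinearMap.range φ.toLinearMap) := by
    rintro _ ⟨n, rfl⟩
    change comul (φ n) ∈ _ ∧ TensorProduct.comm k H H (comul (φ n)) = comul (φ n)
    rw [← CoalgHomClass.map_comp_comul_apply]
    constructor
    · refine ⟨TensorProduct.map φ.toLinearMap.rangeRestrict φ.toLinearMap.rangeRestrict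
        (comul n), ?_⟩
      rw [← LinearMap.comp_apply, ← TensorProduct.map_comp]
      rfl
    · rw [← TensorProduct.map_comm, comm_comul]
  exact (le_sSup h : _ ≤ cocommSubmodule k H) ⟨n, rfl⟩

/-- A coalgebra map from a cocommutative coalgebra to a bialgebra, as a map to the cocommutative
part. -/
def cocommPartLift [AddCommGroup N] [Module k N] [Coalgebra k N] [IsCocomm k N]
    (φ : N →ₗc[k] H) : N →ₗc[k] cocommPart k H where
  toLinearMap := φ.toLinearMap.codRestrict (cocommSubmodule k H) (coalgHom_mem_cocommPart φ)
  counit_comp := φ.counit_comp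
  map_comp_comul := by
    refine LinearMap.ext fun n => cocommPartTensorIncl_injective k ?_
    refine Eq.trans ?_ ((CoalgHomClass.map_comp_comul_apply φ n).trans
      (cocommPartTensorIncl_comul k ⟨φ n, coalgHom_mem_cocommPart φ n⟩).symm)
    rw [LinearMap.comp_apply]
    induction comul (R := k) n with
    | zero => simp
    | add p q hp hq => simp only [map_add, hp, hq]
    | tmul p q => rfl

/-- A bialgebra map from a cocommutative bialgebra, as a map to the cocommutative part. -/
def cocommPartLiftBialgHom [Ring N] [Bialgebra k N] [IsCocomm k N]
    (φ : N →ₐc[k] H) : N →ₐc[k] cocommPart k H :=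
  { cocommPartLift (φ : N →ₗc[k] H) with
    map_one' := Subtype.ext (map_one φ)
    map_mul' := fun x y => Subtype.ext (map_mul φ x y) }

/-- The cocommutative part of the universal bimeasuring bialgebra is universal among cocommutative
bialgebras, because every bialgebra map from one of these lands in the cocommutative part. -/
theorem IsUniversalBimeasuring.restrictCocomm {k T A B : Type u} [Field k] [Ring T] [Bialgebra k T]
    [CommRing A] [Algebra k A] [Ring B] [Bialgebra k B] {θ : B →ₗ[k] T →ₗ[k] A}
    (hθ : IsUniversalBimeasuring θ) : IsUniversalCocommBimeasuring (restrictCocomm θ) where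
  isCocomm := inferInstance
  isBimeasuring := hθ.isBimeasuring.comp_bialgHom (cocommPartIncl k B)
  existsUnique_lift N _ _ _ f hf := by
    obtain ⟨φ, hφ, hu⟩ := hθ.existsUnique_lift N f hf
    refine ⟨cocommPartLiftBialgHom φ, hφ, fun φ' hφ' => ?_⟩
    have h : (cocommPartIncl k B).comp φ' = φ := hu _ hφ'
    exact BialgHom.ext fun n => Subtype.ext (BialgHom.congr_fun h n)

end CocommPart

/-! ### Inclusions into and projections from tensor products -/

section Inclusions

open Coalgebra

variable (k T S : Type*) [Field k] [Ring T] [Bialgebra k T] [Ring S] [Bialgebra k S]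

/-- The inclusion `t ↦ t ⊗ 1`, as a bialgebra map. -/
def includeLeftBialgHom : T →ₐc[k] T ⊗[k] S :=
  (Bialgebra.TensorProduct.map (BialgHom.id k T) (Bialgebra.unitBialgHom k S)).comp
    ((Bialgebra.TensorProduct.rid k k T).symm : T →ₐc[k] T ⊗[k] k)

/-- The inclusion `s ↦ 1 ⊗ s`, as a bialgebra map. -/
def includeRightBialgHom : S →ₐc[k] T ⊗[k] S :=
  (Bialgebra.TensorProduct.map (Bialgebra.unitBialgHom k T) (BialgHom.id k S)).comp
    ((Bialgebra.TensorProduct.lid k S).symm : S →ₐc[k] k ⊗[k] S)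

@[simp]
theorem includeLeftBialgHom_apply (t : T) : includeLeftBialgHom k T S t = t ⊗ₜ 1 := by
  change t ⊗ₜ Bialgebra.unitBialgHom k S 1 = _
  rw [map_one]

@[simp]
theorem includeRightBialgHom_apply (s : S) : includeRightBialgHom k T S s = 1 ⊗ₜ s := by
  change Bialgebra.unitBialgHom k T 1 ⊗ₜ s = _
  rw [map_one]

end Inclusions

section TensorCoalgebra

open Coalgebra

variable {k C D : Type*} [Field k] [AddCommGroup C] [Module k C] [Coalgebra k C]
  [AddCommGroup D] [Module k D] [Coalgebra k D]

/-- The convolution product of the projections `c ⊗ d ↦ ε(d) c` and `c ⊗ d ↦ ε(c) d` is the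
identity of `C ⊗ D`. -/
theorem map_comul_tensorProduct_eq_self {p : C ⊗[k] D →ₗ[k] C} {q : C ⊗[k] D →ₗ[k] D}
    (hp : ∀ c d, p (c ⊗ₜ d) = counit (R := k) d • c)
    (hq : ∀ c d, q (c ⊗ₜ d) = counit (R := k) c • d) (x : C ⊗[k] D) :
    TensorProduct.map p q (comul x) = x := by
  induction x with
  | zero => simp
  | add x y hx hy => simp only [map_add, hx, hy]
  | tmul c d =>
    have h : ∀ (y : C ⊗[k] C) (z : D ⊗[k] D), TensorProduct.map p q
        (TensorProduct.AlgebraTensorModule.tensorTensorTensorComm k k k k C C D D (y ⊗ₜ z)) =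
        TensorProduct.rid k C (counit.lTensor C y) ⊗ₜ
          TensorProduct.lid k D (counit.rTensor D z) := fun y z => by
      induction y with
      | zero => simp
      | add y y' hy hy' => simp only [TensorProduct.add_tmul, map_add, hy, hy']
      | tmul c₁ c₂ =>
      induction z with
      | zero => simp
      | add z z' hz hz' => simp only [TensorProduct.tmul_add, map_add, hz, hz']
      | tmul d₁ d₂ => simp [hp, hq, TensorProduct.smul_tmul', smul_comm (counit (R := k) c₂)]
    rw [TensorProduct.comul_tmul, h, lTensor_counit_comul, rTensor_counit_comul]
    simp

end TensorCoalgebra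

/-! ### Bimeasurings of a tensor product -/

section BimeasuringTensor

open Coalgebra

variable {k T S A BT BS BTS : Type u} [Field k] [Ring T] [Bialgebra k T]
  [Ring S] [Bialgebra k S] [CommRing A] [Algebra k A] [Ring BT] [Bialgebra k BT] [Ring BS]
  [Bialgebra k BS] [Ring BTS] [Bialgebra k BTS]
  {θT : BT →ₗ[k] T →ₗ[k] A} {θS : BS →ₗ[k] S →ₗ[k] A} {θTS : BTS →ₗ[k] (T ⊗[k] S) →ₗ[k] A}
  {α : (BT ⊗[k] BS) →ₐc[k] BTS} {ι₁ : BTS →ₐc[k] BT} {ι₂ : BTS →ₐc[k] BS}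

/-- The composite of `α` with `ι₁` is `f ⊗ g ↦ ε(g) f`: both induce the same pairing with `T`. -/
theorem inducedLeft_tensor (hT : IsUniversalBimeasuring θT) (hS : IsBimeasuring θS)
    (hα : ∀ f g t s, θTS (α (f ⊗ₜ[k] g)) (t ⊗ₜ[k] s) = θT f t * θS g s)
    (hι₁ : ∀ b t, θT (ι₁ b) t = θTS b (t ⊗ₜ[k] 1)) (f : BT) (g : BS) :
    ι₁ (α (f ⊗ₜ g)) = counit (R := k) g • f := by
  let ρ : BT ⊗[k] BS →ₐc[k] BT := (Bialgebra.TensorProduct.rid k k BT : BT ⊗[k] k →ₐc[k] BT).comp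
    (Bialgebra.TensorProduct.map (BialgHom.id k BT) (Bialgebra.counitBialgHom k BS))
  have hρ : ∀ f g, ρ (f ⊗ₜ g) = counit (R := k) g • f := fun _ _ => rfl
  have : ((ι₁.comp α : BT ⊗[k] BS →ₐc[k] BT) : BT ⊗[k] BS →ₗc[k] BT) = ρ := by
    refine hT.coalgHom_ext fun x t => ?_
    change θT (ι₁ (α x)) t = θT (ρ x) t
    induction x with
    | zero => simp
    | add x y hx hy => simp only [map_add, LinearMap.add_apply, hx, hy]
    | tmul f g =>
      have := hS.left.map_one g
      rw [hι₁, hα, hρ, this, map_smul, LinearMap.smul_apply, mul_comm, Algebra.smul_def]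
  exact CoalgHom.congr_fun this (f ⊗ₜ g)

/-- The composite of `α` with `ι₂` is `f ⊗ g ↦ ε(f) g`: both induce the same pairing with `S`. -/
theorem inducedRight_tensor (hT : IsBimeasuring θT) (hS : IsUniversalBimeasuring θS)
    (hα : ∀ f g t s, θTS (α (f ⊗ₜ[k] g)) (t ⊗ₜ[k] s) = θT f t * θS g s)
    (hι₂ : ∀ b s, θS (ι₂ b) s = θTS b (1 ⊗ₜ[k] s)) (f : BT) (g : BS) :
    ι₂ (α (f ⊗ₜ g)) = counit (R := k) f • g := by
  let ρ : BT ⊗[k] BS →ₐc[k] BS := (Bialgebra.TensorProduct.lid k BS : k ⊗[k] BS →ₐc[k] BS).comp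
    (Bialgebra.TensorProduct.map (Bialgebra.counitBialgHom k BT) (BialgHom.id k BS))
  have hρ : ∀ f g, ρ (f ⊗ₜ g) = counit (R := k) f • g := fun _ _ => rfl
  have : ((ι₂.comp α : BT ⊗[k] BS →ₐc[k] BS) : BT ⊗[k] BS →ₗc[k] BS) = ρ := by
    refine hS.coalgHom_ext fun x s => ?_
    change θS (ι₂ (α x)) s = θS (ρ x) s
    induction x with
    | zero => simp
    | add x y hx hy => simp only [map_add, LinearMap.add_apply, hx, hy]
    | tmul f g =>
      have := hT.left.map_one f
      rw [hι₂, hα, hρ, this, map_smul, LinearMap.smul_apply, Algebra.smul_def]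
  exact CoalgHom.congr_fun this (f ⊗ₜ g)

/-- On a cocommutative coalgebra `C`, where the comultiplication is a coalgebra map, `ι₁ * ι₂` is
also a right inverse of `α` on the image of any coalgebra map `j` from `C`: both `j` and
`α ∘ (ι₁ * ι₂) ∘ j` are coalgebra maps that induce the same pairing with `T ⊗ S`. -/
theorem tensor_map_induced_comul (hTS : IsUniversalBimeasuring θTS)
    (hα : ∀ f g t s, θTS (α (f ⊗ₜ[k] g)) (t ⊗ₜ[k] s) = θT f t * θS g s)
    (hι₁ : ∀ b t, θT (ι₁ b) t = θTS b (t ⊗ₜ[k] 1))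
    (hι₂ : ∀ b s, θS (ι₂ b) s = θTS b (1 ⊗ₜ[k] s))
    {C : Type u} [AddCommGroup C] [Module k C] [Coalgebra k C] [IsCocomm k C]
    (j : C →ₗc[k] BTS) (c : C) :
    α (Coalgebra.TensorProduct.map ((ι₁ : BTS →ₗc[k] BT).comp j) ((ι₂ : BTS →ₗc[k] BS).comp j)
      (comul c)) = j c := by
  let m := Coalgebra.TensorProduct.map ((ι₁ : BTS →ₗc[k] BT).comp j) ((ι₂ : BTS →ₗc[k] BS).comp j)
  have : ((α : BT ⊗[k] BS →ₗc[k] BTS).comp m).comp (comulCoalgHom k C) = j := by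
    refine hTS.coalgHom_ext fun c z => ?_
    change θTS (α (m (comul c))) z = θTS (j c) z
    induction z with
    | zero => simp
    | add x y hx hy => simp only [map_add, hx, hy]
    | tmul t s =>
      have h : ∀ w, θTS (α (m w)) (t ⊗ₜ s) = LinearMap.mul' k A (_root_.TensorProduct.map
          (θTS.flip (t ⊗ₜ 1)) (θTS.flip (1 ⊗ₜ s)) (_root_.TensorProduct.map (j : C →ₗ[k] BTS)
            (j : C →ₗ[k] BTS) w)) := fun w => by
        induction w with
        | zero => simp
        | add x y hx hy => simp only [map_add, LinearMap.add_apply, hx, hy]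
        | tmul x y =>
          have hm : m (x ⊗ₜ y) = ι₁ (j x) ⊗ₜ ι₂ (j y) := rfl
          rw [hm, hα, hι₁, hι₂]
          simp
      have hts : t ⊗ₜ[k] s = (t ⊗ₜ 1) * (1 ⊗ₜ s) := by simp
      rw [h, CoalgHomClass.map_comp_comul_apply, ← hTS.isBimeasuring.left.map_mul, ← hts]
  exact CoalgHom.congr_fun this c

end BimeasuringTensor

end

theorem mainTheorem4 {k T S A : Type u} [Field k] [Ring T] [Bialgebra k T]
    [Ring S] [Bialgebra k S] [CommRing A] [Algebra k A] :
    -- the universal bimeasuring bialgebras exist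
    (HasUniversalBimeasuring k T A ∧ HasUniversalBimeasuring k S A ∧
      HasUniversalBimeasuring k (T ⊗[k] S) A) ∧
    -- and for every choice of `B(T, A)`, `B(S, A)` and `B(T ⊗ S, A)`:
    ∀ (BT BS BTS : Type u) [Ring BT] [Bialgebra k BT] [Ring BS] [Bialgebra k BS]
      [Ring BTS] [Bialgebra k BTS]
      (θT : BT →ₗ[k] T →ₗ[k] A) (θS : BS →ₗ[k] S →ₗ[k] A)
      (θTS : BTS →ₗ[k] (T ⊗[k] S) →ₗ[k] A),
      IsUniversalBimeasuring θT → IsUniversalBimeasuring θS → IsUniversalBimeasuring θTS →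
      ∃ (α : (BT ⊗[k] BS) →ₐc[k] BTS) (ι₁ : BTS →ₐc[k] BT) (ι₂ : BTS →ₐc[k] BS),
        -- `α` is the unique coalgebra map (and moreover a bialgebra map) induced by
        -- `(f ⊗ g, t ⊗ s) ↦ θ_T(f, t) θ_S(g, s)`
        (∀ f g t s, θTS (α (f ⊗ₜ[k] g)) (t ⊗ₜ[k] s) = θT f t * θS g s) ∧
        (∀ β : (BT ⊗[k] BS) →ₗc[k] BTS,
          (∀ f g t s, θTS (β (f ⊗ₜ[k] g)) (t ⊗ₜ[k] s) = θT f t * θS g s) →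
            ∀ x, β x = α x) ∧
        -- `ι₁`, `ι₂` are the unique bialgebra maps induced by the inclusions of `T`, `S` in `T ⊗ S`
        (∀ b t, θT (ι₁ b) t = θTS b (t ⊗ₜ[k] 1)) ∧
        (∀ γ : BTS →ₐc[k] BT, (∀ b t, θT (γ b) t = θTS b (t ⊗ₜ[k] 1)) → γ = ι₁) ∧
        (∀ b s, θS (ι₂ b) s = θTS b (1 ⊗ₜ[k] s)) ∧
        (∀ γ : BTS →ₐc[k] BS, (∀ b s, θS (γ b) s = θTS b (1 ⊗ₜ[k] s)) → γ = ι₂) ∧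
        -- their convolution product `b ↦ ι₁(b₁) ⊗ ι₂(b₂)` is a left inverse of `α`
        (∀ x, TensorProduct.map (ι₁ : BTS →ₗ[k] BT) (ι₂ : BTS →ₗ[k] BS)
          (Coalgebra.comul (R := k) (α x)) = x) ∧
        Function.Injective α ∧
        -- the cocommutative parts are the universal cocommutative bimeasuring bialgebras
        IsUniversalCocommBimeasuring (restrictCocomm θT) ∧
        IsUniversalCocommBimeasuring (restrictCocomm θS) ∧
        IsUniversalCocommBimeasuring (T := T ⊗[k] S) (restrictCocomm θTS) ∧
        -- and `α` restricts to an isomorphism of bialgebras between them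
        ∃ e : (cocommPart k BT ⊗[k] cocommPart k BS) ≃ₐc[k] cocommPart k BTS,
          ∀ x y, ((e (x ⊗ₜ[k] y) : cocommPart k BTS) : BTS) =
            α ((x : BT) ⊗ₜ[k] (y : BS)) := by
  refine ⟨⟨hasUniversalBimeasuring, hasUniversalBimeasuring, hasUniversalBimeasuring⟩, ?_⟩
  intro BT BS BTS _ _ _ _ _ _ θT θS θTS hT hS hTS
  obtain ⟨α, hα', -⟩ := hTS.existsUnique_lift (BT ⊗[k] BS) (tensorPairing θT θS)
    (hT.isBimeasuring.tensorPairing hS.isBimeasuring)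
  have hα : ∀ f g t s, θTS (α (f ⊗ₜ[k] g)) (t ⊗ₜ[k] s) = θT f t * θS g s := fun f g t s => by
    rw [hα', tensorPairing_tmul]
  obtain ⟨ι₁, hι₁', hu₁⟩ := hT.existsUnique_lift BTS _
    (hTS.isBimeasuring.compl₂_bialgHom (includeLeftBialgHom k T S))
  have hι₁ : ∀ b t, θT (ι₁ b) t = θTS b (t ⊗ₜ[k] 1) := fun b t => by
    simp [hι₁']
  obtain ⟨ι₂, hι₂', hu₂⟩ := hS.existsUnique_lift BTS _
    (hTS.isBimeasuring.compl₂_bialgHom (includeRightBialgHom k T S))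
  have hι₂ : ∀ b s, θS (ι₂ b) s = θTS b (1 ⊗ₜ[k] s) := fun b s => by
    simp [hι₂']
  have hleft : ∀ x, TensorProduct.map (ι₁ : BTS →ₗ[k] BT) (ι₂ : BTS →ₗ[k] BS)
      (Coalgebra.comul (R := k) (α x)) = x := fun x => by
    rw [← CoalgHomClass.map_comp_comul_apply, ← LinearMap.comp_apply, ← TensorProduct.map_comp]
    exact map_comul_tensorProduct_eq_self (inducedLeft_tensor hT hS.isBimeasuring hα hι₁)
      (inducedRight_tensor hT.isBimeasuring hS hα hι₂) x
  have hinj : Function.Injective α := fun x y hxy => by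
    rw [← hleft x, ← hleft y, hxy]
  refine ⟨α, ι₁, ι₂, hα, ?_, hι₁, fun γ hγ => hu₁ γ fun b t => by simp [hγ], hι₂,
    fun γ hγ => hu₂ γ fun b s => by simp [hγ], hleft, hinj, hT.restrictCocomm, hS.restrictCocomm,
    hTS.restrictCocomm, ?_⟩
  · intro β hβ x
    have : β = (α : (BT ⊗[k] BS) →ₗc[k] BTS) := hTS.coalgHom_ext fun x z => by
      refine LinearMap.congr_fun (LinearMap.congr_fun (f := θTS ∘ₗ β.toLinearMap)
        (g := θTS ∘ₗ (α : (BT ⊗[k] BS) →ₗ[k] BTS)) (TensorProduct.ext' fun f g =>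
          TensorProduct.ext' fun t s => ?_) x) z
      exact (hβ f g t s).trans (hα f g t s).symm
    exact CoalgHom.congr_fun this x
  · let incl := Bialgebra.TensorProduct.map (cocommPartIncl k BT) (cocommPartIncl k BS)
    have hincl : Function.Injective incl := TensorProduct.map_injective_of_flat_flat _ _
      (cocommPart_val_injective k) (cocommPart_val_injective k)
    let e := cocommPartLiftBialgHom (α.comp incl)
    have he : ∀ x, (e x : BTS) = α (incl x) := fun _ => rfl
    refine ⟨BialgEquiv.ofBijective e ⟨fun x y hxy => hincl (hinj ?_), fun b => ?_⟩,
      fun x y => rfl⟩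
    · rw [← he, ← he, hxy]
    · -- the preimage of `b` is `ι₁ b₁ ⊗ ι₂ b₂`, computed inside the cocommutative parts
      let j : cocommPart k BTS →ₗc[k] BTS := (cocommPartIncl k BTS : cocommPart k BTS →ₗc[k] BTS)
      let u₁ := (ι₁ : BTS →ₗc[k] BT).comp j
      let u₂ := (ι₂ : BTS →ₗc[k] BS).comp j
      refine ⟨Coalgebra.TensorProduct.map (cocommPartLift u₁) (cocommPartLift u₂)
        (Coalgebra.comul b), Subtype.ext ?_⟩
      have h : ∀ w, incl (Coalgebra.TensorProduct.map (cocommPartLift u₁) (cocommPartLift u₂) w) =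
          Coalgebra.TensorProduct.map u₁ u₂ w := fun w => by
        induction w with
        | zero => simp
        | add x y hx hy => simp only [map_add, hx, hy]
        | tmul x y => rfl
      rw [he, h]
      exact tensor_map_induced_comul hTS hα hι₁ hι₂ j b
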